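/- Let $\mathcal H$ be a separable real Hilbert space (of finite or infinite dimension), $n\in\mathbb N$, $G:\mathcal H\to\mathbb R^n$ bounded and linear, and let $Y=GX+\zeta$, where $X\sim\mu_{\rm pr}=\mathcal N(0,\mathcal C_{\rm pr})$ is a nondegenerate centred Gaussian random variable in $\mathcal H$ and $\zeta\sim\mathcal N(0,\mathcal C_{\rm obs})$, with $\mathcal C_{\rm obs}$ invertible, is a centred Gaussian random variable in $\mathbb R^n$ independent of $X$. For a realisation $y$ of $Y$ let $\mu_{\rm pos}=\mu_{\rm pos}(y)$ be the posterior distribution, i.e. the conditional distribution of $X$ given $Y=y$, and $\mathcal C_{\rm pos}$ its covariance operator. Let $$R(\mathcal C_{\rm pos}\Vert\mathcal C_{\rm pr})=\mathcal C_{\rm pr}^{-1/2}\mathcal C_{\rm pos}^{1/2}\bigl(\mathcal C_{\rm pr}^{-1/2}\mathcal C_{\rm pos}^{1/2}\bigr)^*-I,$$ and let $(\lambda_i,w_i)_{1\le i\le\dim\mathcal H}$ (all $i\ge 1$ if $\dim\mathcal H=\infty$) be such that $(\lambda_i)_i$ is nondecreasing, $(w_i)_i$ is an orthonormal basis of $\mathcal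 H$ contained in $\operatorname{ran}\mathcal C_{\rm pr}^{1/2}$, and $R(\mathcal C_{\rm pos}\Vert\mathcal C_{\rm pr})=\sum_i\lambda_i\,w_i\otimes w_i$. Then, for almost every realisation $y$ of $Y$, the following hold. (1) For every $i$, $$\frac{\operatorname{Var}_{X\sim\mu_{\rm pos}}(\langle X,\mathcal C_{\rm pr}^{-1/2}w_i\rangle)}{\operatorname{Var}_{X\sim\mu_{\rm pr}}(\langle X,\mathcal C_{\rm pr}^{-1/2}w_i\rangle)}=1+\lambda_i=\frac1{1+\frac{-\lambda_i}{1+\lambda_i}}.$$ (2) Let $0\le r<\dim\mathcal H$ and let $V_r\subset\operatorname{ran}\mathcal C_{\rm pr}^{1/2}$ be a subspace of dimension $r$. Let $(\mathcal C_{\rm pr}^{-1/2}V_r)^{\perp_{\mathcal C_{\rm pr}}}=\{z\in\mathcal H:\langle\mathcal C_{\rm pr}z,\mathcal C_{\rm pr}^{-1/2}v\rangle=0\ \text{for all}\ v\in V_r\}$ be the orthogonal complement of $\mathcal C_{\rm pr}^{-1/2}V_r$ with respect to the inner product $\langle\mathcal C_{\rm pr}\,\cdot,\cdot\rangle$ (equivalently,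 the orthogonal complement of $\mathcal C_{\rm pr}^{1/2}V_r$ in $\mathcal H$). Then $$\min_{z\in(\mathcal C_{\rm pr}^{-1/2}V_r)^{\perp_{\mathcal C_{\rm pr}}}\setminus\{0\}}\frac{\operatorname{Var}_{X\sim\mu_{\rm pos}}(\langle X,z\rangle)}{\operatorname{Var}_{X\sim\mu_{\rm pr}}(\langle X,z\rangle)}=\inf_{z\in(V_r^\perp\cap\operatorname{ran}\mathcal C_{\rm pr}^{1/2})\setminus\{0\}}\frac{\operatorname{Var}_{X\sim\mu_{\rm pos}}(\langle X,\mathcal C_{\rm pr}^{-1/2}z\rangle)}{\operatorname{Var}_{X\sim\mu_{\rm pr}}(\langle X,\mathcal C_{\rm pr}^{-1/2}z\rangle)}\le1+\lambda_{r+1},$$ where the minimum is attained, and the last inequality is an equality for $V_r=\operatorname{span}\{w_1,\dots,w_r\}$. Moreover, some nonzero $z$ that is orthogonal to $\mathcal C_{\rm pr}^{-1/2}V_r$ in the inner product of $\mathcal H$ satisfies $\operatorname{Var}_{X\sim\mu_{\rm pos}}(\langle X,z\rangle)\le(1+\lambda_{r+1})\operatorname{Var}_{X\sim\mu_{\rm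 pr}}(\langle X,z\rangle)$. -/

import Mathlib

open MeasureTheory ProbabilityTheory InnerProductSpace
open scoped RealInnerProductSpace

namespace LinearGaussianInverse

section Operators

variable {H : Type*} [NormedAddCommGroup H] [InnerProductSpace ℝ H] [CompleteSpace H]

open Classical in
/-- The nonnegative self-adjoint square root `C^{1/2}` of a nonnegative self-adjoint bounded
operator `C`: the nonnegative self-adjoint bounded `T` with `T ∘ T = C`, which exists and is
unique for such `C` (for other operators the value is irrelevant). -/
noncomputable def opSqrt (C : H →L[ℝ] H) : H →L[ℝ] H :=
  if h : ∃ T : H →L[ℝ] H, T.IsPositive ∧ T ∘L T = C then h.choose else 0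

/-- The inverse `C^{-1/2} : ran C^{1/2} → H` of `C^{1/2}`, for injective `C^{1/2}`.
Only its values on `ran C^{1/2}` are meaningful. -/
noncomputable def invSqrt (C : H →L[ℝ] H) : H → H :=
  Function.invFun (opSqrt C)

open Classical in
/-- The bounded operator `S = C₁^{-1/2} C₂^{1/2}`, that is, the operator `S` with
`C₁^{1/2} S = C₂^{1/2}`. For injective `C₁^{1/2}` there is at most one such `S`, and there is one
exactly when `ran C₂^{1/2} ⊆ ran C₁^{1/2}`. -/
noncomputable def invSqrtCompSqrt (C₁ C₂ : H →L[ℝ] H) : H →L[ℝ] H :=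
  if h : ∃ S : H →L[ℝ] H, opSqrt C₁ ∘L S = opSqrt C₂ then h.choose else 0

/-- The Feldman–Hajek operator
`R(C₂ ‖ C₁) = C₁^{-1/2} C₂^{1/2} (C₁^{-1/2} C₂^{1/2})^* - I`. -/
noncomputable def feldmanHajek (C₂ C₁ : H →L[ℝ] H) : H →L[ℝ] H :=
  invSqrtCompSqrt C₁ C₂ ∘L ContinuousLinearMap.adjoint (invSqrtCompSqrt C₁ C₂)
    - ContinuousLinearMap.id ℝ H

/-- `(lam i, w i)` is a system of eigenpairs of `R(Cpos ‖ Cpr)`: the `w i` form an orthonormal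
basis of `H` contained in `ran Cpr^{1/2}`, the `lam i` are nondecreasing, and
`R(Cpos ‖ Cpr) = ∑ i, lam i • (w i ⊗ w i)` (strong convergence). -/
structure IsEigensystem (Cpos Cpr : H →L[ℝ] H) {I : Set ℕ} (lam : I → ℝ)
    (w : HilbertBasis I ℝ H) : Prop where
  mono : Monotone lam
  mem_range : ∀ i, w i ∈ Set.range (opSqrt Cpr)
  expansion : ∀ h : H, HasSum (fun i => (lam i * ⟪w i, h⟫) • w i) (feldmanHajek Cpos Cpr h)

end Operators

section Measures

variable {H : Type*} [NormedAddCommGroup H] [InnerProductSpace ℝ H] [CompleteSpace H]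
  [MeasurableSpace H] [BorelSpace H]

/-- The (centred) covariance operator of `μ`: `⟪covOp μ h, k⟫ = cov(⟪h, ·⟫, ⟪k, ·⟫)`. -/
noncomputable def covOp (μ : Measure H) : H →L[ℝ] H :=
  continuousLinearMapOfBilin (covarianceBilin μ)

/-- Nondegenerate centred Gaussian measures: mean zero and positive covariance. -/
structure IsNondegenerateCenteredGaussian (μ : Measure H) : Prop where
  gaussian : IsGaussian μ
  mean_zero : ∫ x, x ∂μ = 0
  nondegenerate : ∀ z : H, z ≠ 0 → 0 < Var[fun x => ⟪x, z⟫; μ]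

/-- The relative variance `Var_{X ∼ μ}(⟪X, z⟫) / Var_{X ∼ ν}(⟪X, z⟫)`. -/
noncomputable def varRatio (μ ν : Measure H) (z : H) : ℝ :=
  Var[fun x => ⟪x, z⟫; μ] / Var[fun x => ⟪x, z⟫; ν]

/-- The values of the relative variance over the nonzero directions `z` which are orthogonal to
`C^{-1/2} V` with respect to the inner product `⟪C ·, ·⟫`. -/
def ratiosOrthogonal (μ ν : Measure H) (C : H →L[ℝ] H) (V : Submodule ℝ H) : Set ℝ :=
  varRatio μ ν '' {z | z ≠ 0 ∧ ∀ v ∈ V, ⟪C z, invSqrt C v⟫ = 0}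

/-- The values of the relative variance over the directions `C^{-1/2} z`, where `z` runs through
the nonzero elements of `V^⊥ ∩ ran C^{1/2}`. -/
def ratiosPreconditioned (μ ν : Measure H) (C : H →L[ℝ] H) (V : Submodule ℝ H) : Set ℝ :=
  (fun z => varRatio μ ν (invSqrt C z)) '' {z | z ≠ 0 ∧ z ∈ Vᗮ ∧ z ∈ Set.range (opSqrt C)}

end Measures

section Posterior

variable {H : Type*} [NormedAddCommGroup H] [InnerProductSpace ℝ H] [CompleteSpace H]
  [SecondCountableTopology H] [MeasurableSpace H] [BorelSpace H]
  {Ω : Type*} [MeasurableSpace Ω] {n : ℕ}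

/-- The posterior distribution of `X` given `Y = y`, where `Y = G X + ζ`:
the regular conditional distribution. -/
noncomputable def posterior (P : Measure Ω) [IsFiniteMeasure P] (X : Ω → H)
    (ζ : Ω → EuclideanSpace ℝ (Fin n)) (G : H →L[ℝ] EuclideanSpace ℝ (Fin n))
    (y : EuclideanSpace ℝ (Fin n)) : Measure H :=
  condDistrib X (fun ω => G (X ω) + ζ ω) P y

end Posterior

end LinearGaussianInverse

/-! Write C₁, C₂ for prior and posterior covariance, S = C₁^{1/2} and R for the Feldman–Hajek
operator. Let N solve (G C₁ G* + Cobs) N = G C₁. Then Z = X - N*Y is uncorrelated with Y, hence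
independent of it by joint Gaussianity, so almost every posterior is the law of N*y + Z. Its
covariance does not depend on y and satisfies C₁ - C₂ = C₁ G* N (`ae_posterior_covOp`,
`inner_gain`). Thus 0 < C₂ ≤ C₁ as forms, and the difference has finite rank. Since S R S = C₂ - C₁,
substituting u = S z turns the relative variance at z into 1 + ⟨R u, u⟩ / ‖u‖²
(`varRatio_eq_one_add_rayleighQuotient`), and both constraint sets become V^⊥ ∩ ran S without 0.
What remains is Courant–Fischer for R. The bound is a dimension count against span{w_0, …, w_r}
(`exists_varRatio_le`). Attainment is the delicate point, because ran S need not be closed. It holds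
because R is nonpositive with finite-dimensional range inside ran S, so minimisation reduces to a
finite-dimensional subspace of ran S (`exists_forall_inner_mul_le`). -/

namespace LinearGaussianInverse

/-! ### Square roots of positive operators and range inclusion. -/

section SquareRoot

/-- The iteration `B ↦ (A + B²) / 2`, whose limit `B` satisfies `(1 - B)² = 1 - A`. -/
noncomputable def sqrtIter {R : Type*} [Ring R] [Module ℝ R] (A : R) : ℕ → R
  | 0 => 0
  | k + 1 => (1 / 2 : ℝ) • (A + sqrtIter A k * sqrtIter A k)

lemma sqrtIter_one_mem (k : ℕ) : 0 ≤ sqrtIter (1 : ℝ) k ∧ sqrtIter (1 : ℝ) k ≤ 1 := by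
  induction k with
  | zero => simp [sqrtIter]
  | succ k ih =>
    simp only [sqrtIter, smul_eq_mul]
    constructor <;> nlinarith [ih.1, ih.2]

/-- The recursion has nonnegative coefficients, so the scalar iteration started from `A = 1` is a
majorant. -/
lemma norm_sqrtIter_le {R : Type*} [NormedRing R] [NormedAlgebra ℝ R] {A : R} (hA : ‖A‖ ≤ 1)
    (k : ℕ) : ‖sqrtIter A k‖ ≤ sqrtIter (1 : ℝ) k := by
  induction k with
  | zero => simp [sqrtIter]
  | succ k ih =>
    simp only [sqrtIter]
    rw [norm_smul, smul_eq_mul, Real.norm_of_nonneg (by norm_num)]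
    gcongr
    refine (norm_add_le _ _).trans (add_le_add hA ((norm_mul_le _ _).trans ?_))
    exact mul_le_mul ih ih (norm_nonneg _) (sqrtIter_one_mem k).1

lemma norm_sqrtIter_succ_sub_le {R : Type*} [NormedRing R] [NormedAlgebra ℝ R] {A : R}
    (hA : ‖A‖ ≤ 1) (k : ℕ) :
    ‖sqrtIter A (k + 1) - sqrtIter A k‖ ≤ sqrtIter (1 : ℝ) (k + 1) - sqrtIter (1 : ℝ) k := by
  induction k with
  | zero =>
    simp only [sqrtIter, mul_zero, add_zero, sub_zero, norm_smul, smul_eq_mul]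
    rw [Real.norm_of_nonneg (by norm_num)]
    gcongr
  | succ k ih =>
    set a := sqrtIter A (k + 1) with ha
    set b := sqrtIter A k with hb
    set s := sqrtIter (1 : ℝ) (k + 1) with hs
    set t := sqrtIter (1 : ℝ) k with ht
    -- Noncommutative difference of squares: a² - b² = a(a - b) + (a - b)b.
    have hstep : sqrtIter A (k + 2) - a = (1 / 2 : ℝ) • (a * (a - b) + (a - b) * b) := by
      have h1 : sqrtIter A (k + 2) = (1 / 2 : ℝ) • (A + a * a) := rfl
      have h2 : a = (1 / 2 : ℝ) • (A + b * b) := rfl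
      rw [h1]
      nth_rewrite 3 [h2]
      rw [← smul_sub]
      congr 1
      noncomm_ring
    have hstep' : sqrtIter (1 : ℝ) (k + 2) - s = (1 / 2 : ℝ) * (s * (s - t) + (s - t) * t) := by
      have h1 : sqrtIter (1 : ℝ) (k + 2) = (1 / 2 : ℝ) * (1 + s * s) := rfl
      have h2 : s = (1 / 2 : ℝ) * (1 + t * t) := rfl
      rw [h1]
      linear_combination (-1 : ℝ) * h2
    have hna : ‖a‖ ≤ s := norm_sqrtIter_le hA _
    have hnb : ‖b‖ ≤ t := norm_sqrtIter_le hA _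
    have hs0 : 0 ≤ s := (sqrtIter_one_mem _).1
    have hd : 0 ≤ s - t := (norm_nonneg _).trans ih
    change ‖sqrtIter A (k + 2) - a‖ ≤ sqrtIter (1 : ℝ) (k + 2) - s
    rw [hstep, hstep', norm_smul, Real.norm_of_nonneg (by norm_num)]
    gcongr
    refine (norm_add_le _ _).trans (add_le_add ?_ ?_) <;>
      refine (norm_mul_le _ _).trans ?_ <;> gcongr

lemma exists_tendsto_sqrtIter {R : Type*} [NormedRing R] [NormedAlgebra ℝ R] [CompleteSpace R]
    {A : R} (hA : ‖A‖ ≤ 1) : ∃ B, Filter.Tendsto (sqrtIter A) Filter.atTop (nhds B) := by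
  have hbdd (k : ℕ) : ∑ i ∈ Finset.range k, (sqrtIter (1 : ℝ) (i + 1) - sqrtIter (1 : ℝ) i) ≤ 1 := by
    rw [Finset.sum_range_sub]
    simpa [sqrtIter] using (sqrtIter_one_mem k).2
  -- The majorant's increments telescope and stay below 1; their nonnegativity is the increment
  -- bound applied to the scalar iteration itself.
  have hsum : Summable fun i => sqrtIter (1 : ℝ) (i + 1) - sqrtIter (1 : ℝ) i :=
    summable_of_sum_range_le (fun i => (norm_nonneg _).trans
      (norm_sqrtIter_succ_sub_le (R := ℝ) (A := 1) (by simp) i)) hbdd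
  refine cauchySeq_tendsto_of_complete (cauchySeq_of_dist_le_of_summable _ (fun i => ?_) hsum)
  rw [dist_comm, dist_eq_norm]
  exact norm_sqrtIter_succ_sub_le hA i

variable {H : Type*} [NormedAddCommGroup H] [InnerProductSpace ℝ H] [CompleteSpace H]

lemma isSelfAdjoint_sqrtIter {A : H →L[ℝ] H} (hA : IsSelfAdjoint A) (k : ℕ) :
    IsSelfAdjoint (sqrtIter A k) := by
  induction k with
  | zero => exact .zero _
  | succ k ih => exact (IsSelfAdjoint.all (1 / 2 : ℝ)).smul (hA.add (by
      simpa [pow_two] using ih.pow 2))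

/-- The norm of a self-adjoint operator is the supremum of its absolute Rayleigh quotients, and
those of `1 - C` lie in [0, 1]. -/
lemma norm_one_sub_le_one {C : H →L[ℝ] H} (hC : C.IsPositive) (hC1 : ‖C‖ ≤ 1) :
    ‖1 - C‖ ≤ 1 := by
  have hsa : IsSelfAdjoint (1 - C) := (IsSelfAdjoint.one _).sub hC.isSelfAdjoint
  rw [ContinuousLinearMap.norm_eq_iSup_rayleighQuotient _ hsa.isSymmetric]
  refine ciSup_le fun x => ?_
  have h0 : 0 ≤ ⟪C x, x⟫ := hC.inner_nonneg_left x
  have h1 : ⟪C x, x⟫ ≤ ‖x‖ ^ 2 := (real_inner_le_norm _ _).trans (by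
    have := C.le_of_opNorm_le hC1 x
    nlinarith [norm_nonneg x])
  have h2 : ⟪(1 - C) x, x⟫ = ‖x‖ ^ 2 - ⟪C x, x⟫ := by
    simp [inner_sub_left]
  simp only [ContinuousLinearMap.rayleighQuotient, ContinuousLinearMap.reApplyInnerSelf_apply,
    RCLike.re_to_real, h2]
  rw [abs_of_nonneg (div_nonneg (by linarith) (by positivity))]
  exact div_le_one_of_le₀ (by linarith) (by positivity)

/-- The limit B of the iteration for `1 - C` is a fixed point, which rearranges to (1 - B)² = C;
positivity of 1 - B follows from ‖B‖ ≤ 1. -/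
lemma exists_isPositive_sqrt_of_norm_le_one {C : H →L[ℝ] H} (hC : C.IsPositive) (hC1 : ‖C‖ ≤ 1) :
    ∃ T : H →L[ℝ] H, T.IsPositive ∧ T ∘L T = C := by
  have hA := norm_one_sub_le_one hC hC1
  have hsa : IsSelfAdjoint (1 - C) := (IsSelfAdjoint.one _).sub hC.isSelfAdjoint
  obtain ⟨B, hB⟩ := exists_tendsto_sqrtIter hA
  have hBsa : IsSelfAdjoint B :=
    (isClosed_eq continuous_star continuous_id).mem_of_tendsto hB
      (.of_forall (isSelfAdjoint_sqrtIter hsa))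
  have hB1 : ‖B‖ ≤ 1 := le_of_tendsto hB.norm
    (.of_forall fun k => (norm_sqrtIter_le hA k).trans (sqrtIter_one_mem k).2)
  have hfix : B = (1 / 2 : ℝ) • ((1 - C) + B * B) :=
    tendsto_nhds_unique (hB.comp (Filter.tendsto_add_atTop_nat 1))
      (((hB.mul hB).const_add (1 - C)).const_smul (1 / 2 : ℝ))
  refine ⟨1 - B, (ContinuousLinearMap.isPositive_iff' _).2
    ⟨(IsSelfAdjoint.one _).sub hBsa, fun x => ?_⟩, ?_⟩
  · have h1 : ⟪B x, x⟫ ≤ ‖x‖ ^ 2 := (real_inner_le_norm _ _).trans (by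
      have := B.le_of_opNorm_le hB1 x
      nlinarith [norm_nonneg x])
    simpa [inner_sub_left] using h1
  · change (1 - B) * (1 - B) = C
    have h2 : (2 : ℝ) • B = (1 - C) + B * B := by
      nth_rewrite 1 [hfix]
      rw [smul_smul]; norm_num
    rw [two_smul] at h2
    have h3 : (1 - B) * (1 - B) = 1 - (B + B) + B * B := by noncomm_ring
    rw [h3, h2]; abel

/-- A positive bounded operator on a real Hilbert space has a positive square root. -/
theorem exists_isPositive_sqrt {C : H →L[ℝ] H} (hC : C.IsPositive) :
    ∃ T : H →L[ℝ] H, T.IsPositive ∧ T ∘L T = C := by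
  have hc : 0 < ‖C‖ + 1 := by positivity
  -- Rescale into the unit ball; the summand 1 covers C = 0.
  obtain ⟨T, hT, hTC⟩ := exists_isPositive_sqrt_of_norm_le_one
    (hC.smul_of_nonneg (c := (‖C‖ + 1)⁻¹) (by positivity)) (by
      rw [norm_smul, norm_inv, Real.norm_of_nonneg hc.le, inv_mul_le_iff₀ hc]; linarith)
  refine ⟨√(‖C‖ + 1) • T, hT.smul_of_nonneg (Real.sqrt_nonneg _), ?_⟩
  rw [ContinuousLinearMap.smul_comp, ContinuousLinearMap.comp_smul, smul_smul,
    Real.mul_self_sqrt hc.le, hTC, smul_inv_smul₀ hc.ne']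

lemma opSqrt_spec {C : H →L[ℝ] H} (hC : C.IsPositive) :
    (opSqrt C).IsPositive ∧ opSqrt C ∘L opSqrt C = C := by
  have h := exists_isPositive_sqrt hC
  rw [opSqrt, dif_pos h]
  exact h.choose_spec

lemma inner_opSqrt_opSqrt {C : H →L[ℝ] H} (hC : C.IsPositive) (x y : H) :
    ⟪opSqrt C x, opSqrt C y⟫ = ⟪C x, y⟫ := by
  obtain ⟨hp, hs⟩ := opSqrt_spec hC
  rw [← hp.inner_left_eq_inner_right]
  exact congrArg (⟪· , y⟫) (DFunLike.congr_fun hs x)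

lemma opSqrt_injective {C : H →L[ℝ] H} (hC : C.IsPositive) (hC0 : ∀ z ≠ 0, 0 < ⟪C z, z⟫) :
    Function.Injective (opSqrt C) := by
  refine (injective_iff_map_eq_zero _).2 fun z hz => by_contra fun h => (hC0 z h).ne ?_
  rw [← inner_opSqrt_opSqrt hC, hz, inner_zero_left]

lemma denseRange_of_isPositive_of_injective {S : H →L[ℝ] H} (hS : S.IsPositive)
    (hinj : Function.Injective S) : DenseRange S := by
  have h : S.rangeᗮ = ⊥ := by
    rw [ContinuousLinearMap.orthogonal_range, hS.isSelfAdjoint.adjoint_eq]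
    exact LinearMap.ker_eq_bot.2 hinj
  have h2 := (Submodule.topologicalClosure_eq_top_iff).2 h
  exact Submodule.dense_iff_topologicalClosure_eq_top.2 h2

/-- Range inclusion of Douglas type: if `‖Q x‖ ≤ ‖S x‖`, then `Q = S T` for some bounded `T`. -/
lemma exists_comp_eq_of_norm_le {S Q : H →L[ℝ] H} (hS : S.IsPositive)
    (hinj : Function.Injective S) (hQ : IsSelfAdjoint Q) (hle : ∀ x, ‖Q x‖ ≤ ‖S x‖) :
    ∃ T : H →L[ℝ] H, S ∘L T = Q := by
  have hd := denseRange_of_isPositive_of_injective hS hinj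
  -- D is the continuous extension of S x ↦ Q x from the dense range of S; the adjoint of D S = Q is
  -- the required factorisation.
  let D : H →L[ℝ] H := (Q : H →ₗ[ℝ] H).extendOfNorm (S : H →ₗ[ℝ] H)
  have hD : D ∘L S = Q := ContinuousLinearMap.ext fun x =>
    LinearMap.extendOfNorm_eq hd ⟨1, fun x => by simpa using hle x⟩ x
  refine ⟨ContinuousLinearMap.adjoint D, ?_⟩
  have h := congrArg ContinuousLinearMap.adjoint hD
  rwa [ContinuousLinearMap.adjoint_comp, hS.isSelfAdjoint.adjoint_eq, hQ.adjoint_eq] at h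

end SquareRoot

/-! ### The Feldman–Hajek operator as a factor of C₂ - C₁. -/

section FeldmanHajek

variable {H : Type*} [NormedAddCommGroup H] [InnerProductSpace ℝ H] [CompleteSpace H]

/-- The form inequality says ‖C₂^{1/2} x‖ ≤ ‖C₁^{1/2} x‖, so the factor exists and `invSqrtCompSqrt`
is not its default value 0. -/
lemma opSqrt_comp_invSqrtCompSqrt {C₁ C₂ : H →L[ℝ] H} (h₁ : C₁.IsPositive) (h₂ : C₂.IsPositive)
    (h0 : ∀ z ≠ 0, 0 < ⟪C₁ z, z⟫) (hle : ∀ z, ⟪C₂ z, z⟫ ≤ ⟪C₁ z, z⟫) :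
    opSqrt C₁ ∘L invSqrtCompSqrt C₁ C₂ = opSqrt C₂ := by
  have h : ∃ S : H →L[ℝ] H, opSqrt C₁ ∘L S = opSqrt C₂ := by
    refine exists_comp_eq_of_norm_le (opSqrt_spec h₁).1 (opSqrt_injective h₁ h0)
      (opSqrt_spec h₂).1.isSelfAdjoint fun x => ?_
    refine (sq_le_sq₀ (norm_nonneg _) (norm_nonneg _)).1 ?_
    rw [← real_inner_self_eq_norm_sq, ← real_inner_self_eq_norm_sq, inner_opSqrt_opSqrt h₁,
      inner_opSqrt_opSqrt h₂]
    exact hle x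
  rw [invSqrtCompSqrt, dif_pos h]
  exact h.choose_spec

/-- `C₁^{1/2} R(C₂ ‖ C₁) C₁^{1/2} = C₂ - C₁`. -/
lemma opSqrt_comp_feldmanHajek {C₁ C₂ : H →L[ℝ] H} (h₁ : C₁.IsPositive) (h₂ : C₂.IsPositive)
    (h0 : ∀ z ≠ 0, 0 < ⟪C₁ z, z⟫) (hle : ∀ z, ⟪C₂ z, z⟫ ≤ ⟪C₁ z, z⟫) :
    opSqrt C₁ ∘L feldmanHajek C₂ C₁ ∘L opSqrt C₁ = C₂ - C₁ := by
  have h := opSqrt_comp_invSqrtCompSqrt h₁ h₂ h0 hle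
  have h' := congrArg ContinuousLinearMap.adjoint h
  rw [ContinuousLinearMap.adjoint_comp, (opSqrt_spec h₁).1.isSelfAdjoint.adjoint_eq,
    (opSqrt_spec h₂).1.isSelfAdjoint.adjoint_eq] at h'
  have e : opSqrt C₁ ∘L feldmanHajek C₂ C₁ ∘L opSqrt C₁ =
      (opSqrt C₁ ∘L invSqrtCompSqrt C₁ C₂) ∘L
        (ContinuousLinearMap.adjoint (invSqrtCompSqrt C₁ C₂) ∘L opSqrt C₁) -
      opSqrt C₁ ∘L opSqrt C₁ := by
    ext x
    simp [feldmanHajek]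
  rw [e, h, h', (opSqrt_spec h₁).2, (opSqrt_spec h₂).2]

lemma inner_eq_add_inner_feldmanHajek {C₁ C₂ : H →L[ℝ] H} (h₁ : C₁.IsPositive)
    (h₂ : C₂.IsPositive) (h0 : ∀ z ≠ 0, 0 < ⟪C₁ z, z⟫) (hle : ∀ z, ⟪C₂ z, z⟫ ≤ ⟪C₁ z, z⟫) (z : H) :
    ⟪C₂ z, z⟫ = ‖opSqrt C₁ z‖ ^ 2 +
      ⟪feldmanHajek C₂ C₁ (opSqrt C₁ z), opSqrt C₁ z⟫ := by
  rw [← (opSqrt_spec h₁).1.inner_left_eq_inner_right, ← real_inner_self_eq_norm_sq,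
    inner_opSqrt_opSqrt h₁]
  have := DFunLike.congr_fun (opSqrt_comp_feldmanHajek h₁ h₂ h0 hle) z
  simp only [ContinuousLinearMap.comp_apply, sub_apply] at this
  rw [this, inner_sub_left]; ring

lemma invSqrt_opSqrt {C : H →L[ℝ] H} (hC : C.IsPositive) (hC0 : ∀ z ≠ 0, 0 < ⟪C z, z⟫) (z : H) :
    invSqrt C (opSqrt C z) = z :=
  Function.leftInverse_invFun (opSqrt_injective hC hC0) z

end FeldmanHajek

/-! ### Minimisation of quadratic forms and eigenvalue expansions. -/

section Variational

variable {H : Type*} [NormedAddCommGroup H] [InnerProductSpace ℝ H]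

/-- The projection onto V, restricted to the larger space U, has a kernel. -/
lemma exists_mem_orthogonal_of_finrank_lt (U V : Submodule ℝ H) [FiniteDimensional ℝ U]
    [FiniteDimensional ℝ V] (h : Module.finrank ℝ V < Module.finrank ℝ U) :
    ∃ u ∈ U, u ≠ 0 ∧ u ∈ Vᗮ := by
  obtain ⟨u, hu, hu0⟩ := Submodule.exists_mem_ne_zero_of_ne_bot
    (LinearMap.ker_ne_bot_of_finrank_lt
      (f := (V.orthogonalProjectionOnto : H →ₗ[ℝ] V) ∘ₗ U.subtype) h)
  refine ⟨u, u.2, by simpa using hu0, ?_⟩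
  have hu' : V.orthogonalProjectionOnto (u : H) = 0 := hu
  exact (Submodule.orthogonalProjectionOnto_eq_zero_iff).1 hu'

/-- The quadratic form of a finite rank symmetric nonpositive operator `R` attains its minimum
relative to `‖·‖²` over `Vᗮ`, at a point of any subspace `D` containing `V` and the range of `R`
and meeting `Vᗮ` nontrivially. -/
lemma exists_forall_inner_mul_le {R : H →L[ℝ] H} (hR : (R : H →ₗ[ℝ] H).IsSymmetric)
    (hneg : ∀ u, ⟪R u, u⟫ ≤ 0) [FiniteDimensional ℝ R.range] {V D : Submodule ℝ H}
    [FiniteDimensional ℝ V] (hVD : V ≤ D) (hRD : R.range ≤ D) {u₀ : H} (hu₀ : u₀ ≠ 0)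
    (hu₀V : u₀ ∈ Vᗮ) (hu₀D : u₀ ∈ D) :
    ∃ p ∈ D, p ∈ Vᗮ ∧ ‖p‖ = 1 ∧ ∀ u ∈ Vᗮ, ⟪R p, p⟫ * ‖u‖ ^ 2 ≤ ⟪R u, u⟫ := by
  -- On Vᗮ only the compression of R matters, and its range is the projected range of R. Adding u₀
  -- makes F nonzero even when that range is trivial.
  let F : Submodule ℝ H := R.range.map (Vᗮ.starProjection : H →ₗ[ℝ] H) ⊔ ℝ ∙ u₀
  have hFV : F ≤ Vᗮ := by
    refine sup_le ?_ (by simpa using hu₀V)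
    rintro _ ⟨x, -, rfl⟩
    exact Vᗮ.starProjection_apply_mem x
  have hFD : F ≤ D := by
    refine sup_le ?_ (by simpa using hu₀D)
    rintro _ ⟨x, hx, rfl⟩
    have : Vᗮ.starProjection x = x - V.starProjection x := by
      rw [Submodule.starProjection_orthogonal']; rfl
    change Vᗮ.starProjection x ∈ D
    rw [this]
    exact D.sub_mem (hRD hx) (hVD (V.starProjection_apply_mem x))
  have hu₀F : u₀ ∈ F := Submodule.mem_sup_right (Submodule.mem_span_singleton_self u₀)
  have : Nontrivial F := ⟨⟨⟨u₀, hu₀F⟩, 0, by simpa [Subtype.ext_iff] using hu₀⟩⟩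
  obtain ⟨p, hp, hpmin⟩ := (isCompact_sphere (0 : F) 1).exists_isMinOn
    (NormedSpace.sphere_nonempty.2 zero_le_one)
    (f := fun p : F => ⟪R (p : H), (p : H)⟫) (by fun_prop)
  have hp1 : ‖(p : H)‖ = 1 := by simpa using hp
  have hmin (q : F) : ⟪R (p : H), (p : H)⟫ * ‖(q : H)‖ ^ 2 ≤ ⟪R (q : H), (q : H)⟫ := by
    rcases eq_or_ne q 0 with rfl | hq
    · simp
    have hq0 : 0 < ‖(q : H)‖ := by simpa using hq
    have h := hpmin (a := (‖(q : H)‖⁻¹ : ℝ) • q) (by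
      simp [norm_smul, hq0.ne'])
    simp only [Set.mem_ofPred_eq, Submodule.coe_smul, map_smul, inner_smul_left, inner_smul_right,
      conj_trivial] at h
    calc _ ≤ (‖(q : H)‖⁻¹ * (‖(q : H)‖⁻¹ * ⟪R (q : H), (q : H)⟫)) * ‖(q : H)‖ ^ 2 := by gcongr
      _ = _ := by field_simp
  refine ⟨p, hFD p.2, hFV p.2, hp1, fun u hu => ?_⟩
  -- The part of u orthogonal to F contributes nothing to the form.
  set q : H := u - F.starProjection u with hq
  have hqF : q ∈ Fᗮ := F.sub_starProjection_mem_orthogonal u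
  have hqV : q ∈ Vᗮ := Vᗮ.sub_mem hu (hFV (F.starProjection_apply_mem u))
  have hRq (x : H) : ⟪R x, q⟫ = 0 := by
    have h1 : ⟪Vᗮ.starProjection (R x), q⟫ = 0 :=
      (Submodule.mem_orthogonal F q).1 hqF _ (Submodule.mem_sup_left ⟨R x, ⟨x, rfl⟩, rfl⟩)
    rwa [Submodule.inner_starProjection_left_eq_right,
      Submodule.starProjection_eq_self_iff.2 hqV] at h1
  set v : H := F.starProjection u with hv
  have hu' : u = v + q := by rw [hq]; abel
  have hval : ⟪R u, u⟫ = ⟪R v, v⟫ := by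
    have h2 : ⟪R q, v⟫ = 0 := by
      have := hR q v
      simp only [ContinuousLinearMap.coe_coe] at this
      rw [this, real_inner_comm, hRq]
    rw [hu', map_add, inner_add_left, inner_add_right, inner_add_right, hRq, hRq, h2]
    ring
  have hnorm : ‖v‖ ^ 2 ≤ ‖u‖ ^ 2 := by
    gcongr
    exact F.norm_starProjection_apply_le u
  rw [hval]
  -- Projecting u to v shrinks the norm; since the minimum is nonpositive, the bound for v implies
  -- that for u.
  exact (mul_le_mul_of_nonpos_left hnorm (hneg _)).trans
    (hmin ⟨v, F.starProjection_apply_mem u⟩)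

variable {I : Set ℕ} {lam : I → ℝ} {w : HilbertBasis I ℝ H} {R : H →L[ℝ] H}

lemma hasSum_inner_expansion (hexp : ∀ h, HasSum (fun i => (lam i * ⟪w i, h⟫) • w i) (R h))
    (u : H) : HasSum (fun i => lam i * ⟪w i, u⟫ ^ 2) ⟪R u, u⟫ := by
  have h := (hexp u).mapL (innerSL ℝ u)
  rw [real_inner_comm]
  have e (i : I) : innerSL ℝ u ((lam i * ⟪w i, u⟫) • w i) = lam i * ⟪w i, u⟫ ^ 2 := by
    rw [innerSL_apply_apply, inner_smul_right, real_inner_comm (w i) u]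
    ring
  simp only [e] at h
  exact h

lemma HilbertBasis.hasSum_inner_sq (w : HilbertBasis I ℝ H) (u : H) :
    HasSum (fun i => ⟪w i, u⟫ ^ 2) (‖u‖ ^ 2) := by
  have h := w.hasSum_inner_mul_inner u u
  rw [real_inner_self_eq_norm_sq] at h
  have e (i : I) : ⟪u, w i⟫ * ⟪w i, u⟫ = ⟪w i, u⟫ ^ 2 := by
    rw [real_inner_comm (w i) u, pow_two]
  simp only [e] at h
  exact h

lemma apply_basis_of_expansion
    (hexp : ∀ h, HasSum (fun i => (lam i * ⟪w i, h⟫) • w i) (R h)) (i : I) :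
    R (w i) = lam i • w i := by
  refine (hexp (w i)).unique ?_
  convert hasSum_single (f := fun j => (lam j * ⟪w j, w i⟫) • w j) i fun j hj => ?_ using 1
  · simp [w.orthonormal.norm_eq_one]
  · simp [w.orthonormal.inner_eq_zero hj]

/-- Compare the eigenexpansion with Parseval's identity term by term; this and the next lemma are
the two halves of Courant–Fischer. -/
lemma inner_le_of_inner_eq_zero_of_gt
    (hexp : ∀ h, HasSum (fun i => (lam i * ⟪w i, h⟫) • w i) (R h)) (hmono : Monotone lam) {r : I}
    {u : H} (hu : ∀ i, r < i → ⟪w i, u⟫ = 0) : ⟪R u, u⟫ ≤ lam r * ‖u‖ ^ 2 := by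
  refine hasSum_le (fun i => ?_) (hasSum_inner_expansion hexp u)
    ((HilbertBasis.hasSum_inner_sq w u).mul_left (lam r))
  rcases le_or_gt i r with hi | hi
  · exact mul_le_mul_of_nonneg_right (hmono hi) (sq_nonneg _)
  · simp [hu i hi]

lemma le_inner_of_inner_eq_zero_of_lt
    (hexp : ∀ h, HasSum (fun i => (lam i * ⟪w i, h⟫) • w i) (R h)) (hmono : Monotone lam) {r : I}
    {u : H} (hu : ∀ i, i < r → ⟪w i, u⟫ = 0) : lam r * ‖u‖ ^ 2 ≤ ⟪R u, u⟫ := by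
  refine hasSum_le (fun i => ?_) ((HilbertBasis.hasSum_inner_sq w u).mul_left (lam r))
    (hasSum_inner_expansion hexp u)
  rcases le_or_gt r i with hi | hi
  · exact mul_le_mul_of_nonneg_right (hmono hi) (sq_nonneg _)
  · simp [hu i hi]

lemma inner_eq_zero_of_mem_span_image (w : HilbertBasis I ℝ H) {s : Set I} {u : H}
    (hu : u ∈ Submodule.span ℝ (w '' s)) {i : I} (hi : i ∉ s) : ⟪w i, u⟫ = 0 := by
  have h : Submodule.span ℝ (w '' s) ≤ (ℝ ∙ w i)ᗮ := by
    rw [Submodule.span_le]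
    rintro _ ⟨j, hj, rfl⟩
    exact Submodule.mem_orthogonal_singleton_iff_inner_right.2
      (w.orthonormal.inner_eq_zero fun h => hi (h ▸ hj))
  exact Submodule.mem_orthogonal_singleton_iff_inner_right.1 (h hu)

lemma finrank_span_image_Iic (hI : IsLowerSet I) (w : HilbertBasis I ℝ H) (r : I) :
    FiniteDimensional ℝ (Submodule.span ℝ (w '' Set.Iic r)) ∧
      Module.finrank ℝ (Submodule.span ℝ (w '' Set.Iic r)) = r + 1 := by
  -- A lower set contains every index up to r, and counting starts at 0, hence dimension r + 1.
  let e : Fin (r + 1) → I := fun k => ⟨k, hI (Nat.lt_succ_iff.1 k.2) r.2⟩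
  have he : w '' Set.Iic r = Set.range (w ∘ e) := by
    rw [Set.range_comp]
    congr 1
    ext i
    refine ⟨fun hi => ⟨⟨i, Nat.lt_succ_of_le hi⟩, rfl⟩, ?_⟩
    rintro ⟨k, rfl⟩
    exact Nat.lt_succ_iff.1 k.2
  have hinj : Function.Injective e := fun a b hab => Fin.ext (congrArg (fun i : I => (i : ℕ)) hab)
  rw [he]
  refine ⟨FiniteDimensional.span_of_finite ℝ (Set.finite_range _), ?_⟩
  rw [finrank_span_eq_card (w.orthonormal.linearIndependent.comp e hinj), Fintype.card_fin]

lemma finrank_comap_of_le_range {S : H →L[ℝ] H} (hS : Function.Injective S) {U : Submodule ℝ H}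
    [FiniteDimensional ℝ U] (hU : U ≤ S.range) :
    FiniteDimensional ℝ (U.comap (S : H →ₗ[ℝ] H)) ∧
      Module.finrank ℝ (U.comap (S : H →ₗ[ℝ] H)) = Module.finrank ℝ U := by
  have e := Submodule.equivMapOfInjective (S : H →ₗ[ℝ] H) hS (U.comap (S : H →ₗ[ℝ] H))
  rw [Submodule.map_comap_eq_of_le hU] at e
  exact ⟨e.symm.finiteDimensional, e.finrank_eq⟩

end Variational

/-! ### Rayleigh quotients of the Feldman–Hajek operator. -/

section Rayleigh

variable {H : Type*} [NormedAddCommGroup H] [InnerProductSpace ℝ H] [CompleteSpace H]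
  {C₁ C₂ : H →L[ℝ] H}

lemma feldmanHajek_isSymmetric (C₁ C₂ : H →L[ℝ] H) :
    (feldmanHajek C₂ C₁ : H →ₗ[ℝ] H).IsSymmetric :=
  ((ContinuousLinearMap.isPositive_self_comp_adjoint _).isSelfAdjoint.sub
    (IsSelfAdjoint.one (H →L[ℝ] H))).isSymmetric

/-- On the dense range of C₁^{1/2} the form equals that of C₂ - C₁. -/
lemma inner_feldmanHajek_nonpos (h₁ : C₁.IsPositive) (h₂ : C₂.IsPositive)
    (h0 : ∀ z ≠ 0, 0 < ⟪C₁ z, z⟫) (hle : ∀ z, ⟪C₂ z, z⟫ ≤ ⟪C₁ z, z⟫) (u : H) :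
    ⟪feldmanHajek C₂ C₁ u, u⟫ ≤ 0 := by
  refine (denseRange_of_isPositive_of_injective (opSqrt_spec h₁).1
    (opSqrt_injective h₁ h0)).induction_on (p := fun u => ⟪feldmanHajek C₂ C₁ u, u⟫ ≤ 0) u
    (isClosed_le (by fun_prop) (by fun_prop)) fun z => ?_
  have h := inner_eq_add_inner_feldmanHajek h₁ h₂ h0 hle z
  have h' := inner_opSqrt_opSqrt h₁ z z
  rw [real_inner_self_eq_norm_sq] at h'
  linarith [hle z]

/-- If `C₁ - C₂` maps into `C₁ F`, then `R(C₂ ‖ C₁)` maps into `C₁^{1/2} F`. -/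
lemma range_feldmanHajek_le (h₁ : C₁.IsPositive) (h₂ : C₂.IsPositive)
    (h0 : ∀ z ≠ 0, 0 < ⟪C₁ z, z⟫) (hle : ∀ z, ⟪C₂ z, z⟫ ≤ ⟪C₁ z, z⟫) (F : Submodule ℝ H)
    [FiniteDimensional ℝ F] (hF : ∀ z, ∃ b ∈ F, C₁ z - C₂ z = C₁ b) :
    (feldmanHajek C₂ C₁).range ≤ F.map (opSqrt C₁ : H →ₗ[ℝ] H) := by
  rintro _ ⟨u, rfl⟩
  -- A finite-dimensional target is closed, so vectors u = C₁^{1/2} z suffice.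
  refine (denseRange_of_isPositive_of_injective (opSqrt_spec h₁).1
    (opSqrt_injective h₁ h0)).induction_on
    (p := fun u => feldmanHajek C₂ C₁ u ∈ F.map (opSqrt C₁ : H →ₗ[ℝ] H)) u
    ((Submodule.closed_of_finiteDimensional _).preimage (by fun_prop)) fun z => ?_
  obtain ⟨b, hb, hbz⟩ := hF z
  refine ⟨-b, F.neg_mem hb, opSqrt_injective h₁ h0 ?_⟩
  have h := DFunLike.congr_fun (opSqrt_comp_feldmanHajek h₁ h₂ h0 hle) z
  simp only [ContinuousLinearMap.comp_apply, sub_apply] at h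
  rw [h, ← neg_sub (C₁ z), hbz, ContinuousLinearMap.coe_coe, map_neg, map_neg]
  exact congrArg Neg.neg (DFunLike.congr_fun (opSqrt_spec h₁).2 b)

lemma exists_isLeast_rayleighQuotient (h₁ : C₁.IsPositive) (h₂ : C₂.IsPositive)
    (h0 : ∀ z ≠ 0, 0 < ⟪C₁ z, z⟫) (hle : ∀ z, ⟪C₂ z, z⟫ ≤ ⟪C₁ z, z⟫) (F : Submodule ℝ H)
    [FiniteDimensional ℝ F] (hF : ∀ z, ∃ b ∈ F, C₁ z - C₂ z = C₁ b) {V : Submodule ℝ H}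
    [FiniteDimensional ℝ V] (hV : (V : Set H) ⊆ Set.range (opSqrt C₁)) {u₀ : H} (hu₀ : u₀ ≠ 0)
    (hu₀V : u₀ ∈ Vᗮ) (hu₀S : u₀ ∈ Set.range (opSqrt C₁)) :
    ∃ m, IsLeast ((fun u => 1 + (feldmanHajek C₂ C₁).rayleighQuotient u) ''
      {u | u ≠ 0 ∧ u ∈ Vᗮ ∧ u ∈ Set.range (opSqrt C₁)}) m := by
  have hr := range_feldmanHajek_le h₁ h₂ h0 hle F hF
  have : FiniteDimensional ℝ (feldmanHajek C₂ C₁).range := Submodule.finiteDimensional_of_le hr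
  -- Taking D = ran C₁^{1/2} keeps the minimiser in the range, so it comes from an actual direction
  -- z.
  obtain ⟨p, hpS, hpV, hp1, hp⟩ := exists_forall_inner_mul_le (feldmanHajek_isSymmetric C₁ C₂)
    (inner_feldmanHajek_nonpos h₁ h₂ h0 hle) (D := (opSqrt C₁).range) hV
    (hr.trans LinearMap.map_le_range) hu₀ hu₀V hu₀S
  refine ⟨_, ⟨p, ⟨by rintro rfl; simp at hp1, hpV, hpS⟩, rfl⟩, ?_⟩
  rintro _ ⟨u, ⟨hu0, huV, -⟩, rfl⟩
  have hn : 0 < ‖u‖ ^ 2 := by positivity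
  refine add_le_add_right ((le_div_iff₀ hn).2 ?_) 1
  simpa [ContinuousLinearMap.rayleighQuotient, ContinuousLinearMap.reApplyInnerSelf_apply, hp1]
    using hp u huV

variable {I : Set ℕ} {lam : I → ℝ} {w : HilbertBasis I ℝ H}

lemma rayleighQuotient_basis (hw : IsEigensystem C₂ C₁ lam w) (i : I) :
    (feldmanHajek C₂ C₁).rayleighQuotient (w i) = lam i := by
  simp [ContinuousLinearMap.rayleighQuotient, ContinuousLinearMap.reApplyInnerSelf_apply,
    apply_basis_of_expansion hw.expansion, inner_smul_left,
    w.orthonormal.norm_eq_one]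

lemma isLeast_rayleighQuotient_span (hw : IsEigensystem C₂ C₁ lam w) (r : I) :
    IsLeast ((fun u => 1 + (feldmanHajek C₂ C₁).rayleighQuotient u) ''
      {u | u ≠ 0 ∧ u ∈ (Submodule.span ℝ (w '' {i | i < r}))ᗮ ∧ u ∈ Set.range (opSqrt C₁)})
      (1 + lam r) := by
  refine ⟨⟨w r, ⟨w.orthonormal.ne_zero r, ?_, hw.mem_range r⟩, ?_⟩, ?_⟩
  · rw [Submodule.mem_orthogonal']
    intro u hu
    exact inner_eq_zero_of_mem_span_image w hu (by simp)
  · exact congrArg (1 + ·) (rayleighQuotient_basis hw r)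
  · rintro _ ⟨u, ⟨hu0, huV, -⟩, rfl⟩
    have hn : 0 < ‖u‖ ^ 2 := by positivity
    exact add_le_add_right ((le_div_iff₀ hn).2 (le_inner_of_inner_eq_zero_of_lt hw.expansion
      hw.mono fun i hi => (Submodule.mem_orthogonal _ _).1 huV _
        (Submodule.subset_span ⟨i, hi, rfl⟩))) 1

end Rayleigh

/-! ### Relative variances as Rayleigh quotients. -/

section Ratios

variable {H : Type*} [NormedAddCommGroup H] [InnerProductSpace ℝ H] [CompleteSpace H]
  [MeasurableSpace H] {C₁ C₂ : H →L[ℝ] H} {μ ν : Measure H}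

lemma varRatio_eq_one_add_rayleighQuotient (h₁ : C₁.IsPositive) (h₂ : C₂.IsPositive)
    (h0 : ∀ z ≠ 0, 0 < ⟪C₁ z, z⟫) (hle : ∀ z, ⟪C₂ z, z⟫ ≤ ⟪C₁ z, z⟫)
    (hμ : ∀ z, Var[fun x => ⟪x, z⟫; μ] = ⟪C₂ z, z⟫)
    (hν : ∀ z, Var[fun x => ⟪x, z⟫; ν] = ⟪C₁ z, z⟫) {z : H} (hz : z ≠ 0) :
    varRatio μ ν z = 1 + (feldmanHajek C₂ C₁).rayleighQuotient (opSqrt C₁ z) := by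
  have hn : ⟪C₁ z, z⟫ = ‖opSqrt C₁ z‖ ^ 2 := by
    rw [← real_inner_self_eq_norm_sq, inner_opSqrt_opSqrt h₁]
  have hpos := h0 z hz
  rw [hn] at hpos
  rw [varRatio, hμ, hν, inner_eq_add_inner_feldmanHajek h₁ h₂ h0 hle, hn, add_div,
    div_self hpos.ne']
  rfl

/-- Put u = C₁^{1/2} z: then ⟨C₁ z, C₁^{-1/2} v⟩ = ⟨u, v⟩. The preconditioned ratios have the same
image, so both sets coincide. -/
lemma ratiosOrthogonal_eq_image (h₁ : C₁.IsPositive) (h0 : ∀ z ≠ 0, 0 < ⟪C₁ z, z⟫)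
    {f : H → ℝ} (hf : ∀ z ≠ 0, varRatio μ ν z = f (opSqrt C₁ z)) {V : Submodule ℝ H}
    (hV : (V : Set H) ⊆ Set.range (opSqrt C₁)) :
    ratiosOrthogonal μ ν C₁ V = f '' {u | u ≠ 0 ∧ u ∈ Vᗮ ∧ u ∈ Set.range (opSqrt C₁)} := by
  have key (z : H) : (∀ v ∈ V, ⟪C₁ z, invSqrt C₁ v⟫ = 0) ↔ opSqrt C₁ z ∈ Vᗮ := by
    rw [Submodule.mem_orthogonal']
    refine forall₂_congr fun v hv => ?_
    obtain ⟨y, rfl⟩ := hV hv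
    rw [invSqrt_opSqrt h₁ h0, inner_opSqrt_opSqrt h₁]
  have hz0 (z : H) : opSqrt C₁ z = 0 ↔ z = 0 :=
    map_eq_zero_iff _ (opSqrt_injective h₁ h0)
  ext m
  constructor
  · rintro ⟨z, ⟨hz, hzV⟩, rfl⟩
    exact ⟨opSqrt C₁ z, ⟨(hz0 z).not.2 hz, (key z).1 hzV, ⟨z, rfl⟩⟩, (hf z hz).symm⟩
  · rintro ⟨_, ⟨hz, hzV, ⟨z, rfl⟩⟩, rfl⟩
    exact ⟨z, ⟨(hz0 z).not.1 hz, (key z).2 hzV⟩, hf z ((hz0 z).not.1 hz)⟩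

lemma ratiosPreconditioned_eq_image (h₁ : C₁.IsPositive) (h0 : ∀ z ≠ 0, 0 < ⟪C₁ z, z⟫)
    {f : H → ℝ} (hf : ∀ z ≠ 0, varRatio μ ν z = f (opSqrt C₁ z)) (V : Submodule ℝ H) :
    ratiosPreconditioned μ ν C₁ V = f '' {u | u ≠ 0 ∧ u ∈ Vᗮ ∧ u ∈ Set.range (opSqrt C₁)} := by
  refine Set.image_congr ?_
  rintro _ ⟨hz, -, ⟨z, rfl⟩⟩
  rw [invSqrt_opSqrt h₁ h0, hf]
  rintro rfl
  simp at hz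

variable {I : Set ℕ} {lam : I → ℝ} {w : HilbertBasis I ℝ H}

lemma exists_varRatio_le (h₁ : C₁.IsPositive) (h0 : ∀ z ≠ 0, 0 < ⟪C₁ z, z⟫)
    (hf : ∀ z ≠ 0, varRatio μ ν z = 1 + (feldmanHajek C₂ C₁).rayleighQuotient (opSqrt C₁ z))
    (hI : IsLowerSet I) (hw : IsEigensystem C₂ C₁ lam w) (r : I) {V : Submodule ℝ H}
    [FiniteDimensional ℝ V] (hVr : Module.finrank ℝ V = (r : ℕ)) :
    (∃ u, u ≠ 0 ∧ u ∈ Vᗮ ∧ u ∈ Set.range (opSqrt C₁) ∧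
      (feldmanHajek C₂ C₁).rayleighQuotient u ≤ lam r) ∧
    ((V : Set H) ⊆ Set.range (opSqrt C₁) →
      ∃ z : H, z ≠ 0 ∧ (∀ v ∈ V, ⟪z, invSqrt C₁ v⟫ = 0) ∧ varRatio μ ν z ≤ 1 + lam r) := by
  have hinj := opSqrt_injective h₁ h0
  obtain ⟨hUfin, hUr⟩ := finrank_span_image_Iic hI w r
  set U := Submodule.span ℝ (w '' Set.Iic r) with hU
  have hUS : U ≤ (opSqrt C₁).range := by
    rw [hU, Submodule.span_le]
    rintro _ ⟨i, -, rfl⟩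
    exact hw.mem_range i
  have hray {u : H} (hu : u ∈ U) (hu0 : u ≠ 0) :
      (feldmanHajek C₂ C₁).rayleighQuotient u ≤ lam r := by
    have hn : 0 < ‖u‖ ^ 2 := by positivity
    exact (div_le_iff₀ hn).2 (inner_le_of_inner_eq_zero_of_gt hw.expansion hw.mono fun i hi =>
      inner_eq_zero_of_mem_span_image w hu (by simpa using hi))
  refine ⟨?_, fun hV => ?_⟩
  · obtain ⟨u, huU, hu0, huV⟩ := exists_mem_orthogonal_of_finrank_lt U V (by lia)
    exact ⟨u, hu0, huV, hUS huU, hray huU hu0⟩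
  -- For orthogonality in H itself, run the same dimension count on the preimages of U and V under
  -- C₁^{1/2}, which keep their dimensions.
  · obtain ⟨hU'fin, hU'⟩ := finrank_comap_of_le_range hinj hUS
    obtain ⟨hV'fin, hV'⟩ := finrank_comap_of_le_range hinj (U := V) hV
    obtain ⟨z, hzU, hz0, hzV⟩ := exists_mem_orthogonal_of_finrank_lt
      (U.comap (opSqrt C₁ : H →ₗ[ℝ] H)) (V.comap (opSqrt C₁ : H →ₗ[ℝ] H)) (by lia)
    refine ⟨z, hz0, fun v hv => ?_, ?_⟩
    · obtain ⟨y, rfl⟩ := hV hv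
      rw [invSqrt_opSqrt h₁ h0]
      exact (Submodule.mem_orthogonal' _ _).1 hzV y hv
    · rw [hf z hz0]
      have := hray (u := opSqrt C₁ z) hzU (by
        rw [← map_zero (opSqrt C₁)]; exact hinj.ne hz0)
      linarith

theorem relative_variance_of_isEigensystem (h₁ : C₁.IsPositive) (h₂ : C₂.IsPositive)
    (h0 : ∀ z ≠ 0, 0 < ⟪C₁ z, z⟫) (h0' : ∀ z ≠ 0, 0 < ⟪C₂ z, z⟫)
    (hle : ∀ z, ⟪C₂ z, z⟫ ≤ ⟪C₁ z, z⟫) (F : Submodule ℝ H)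
    [FiniteDimensional ℝ F] (hF : ∀ z, ∃ b ∈ F, C₁ z - C₂ z = C₁ b)
    (hμ : ∀ z, Var[fun x => ⟪x, z⟫; μ] = ⟪C₂ z, z⟫)
    (hν : ∀ z, Var[fun x => ⟪x, z⟫; ν] = ⟪C₁ z, z⟫)
    (hI : IsLowerSet I) (hw : IsEigensystem C₂ C₁ lam w) :
    (∀ i : I, varRatio μ ν (invSqrt C₁ (w i)) = 1 + lam i ∧
      1 + lam i = 1 / (1 + (-lam i) / (1 + lam i))) ∧
    (∀ r : I,
      (∀ V : Submodule ℝ H, FiniteDimensional ℝ V → Module.finrank ℝ V = (r : ℕ) →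
        (V : Set H) ⊆ Set.range (opSqrt C₁) →
        (∃ m : ℝ, IsLeast (ratiosOrthogonal μ ν C₁ V) m ∧
          IsGLB (ratiosPreconditioned μ ν C₁ V) m ∧ m ≤ 1 + lam r) ∧
        (∃ z : H, z ≠ 0 ∧ (∀ v ∈ V, ⟪z, invSqrt C₁ v⟫ = 0) ∧ varRatio μ ν z ≤ 1 + lam r)) ∧
      IsLeast (ratiosOrthogonal μ ν C₁ (Submodule.span ℝ (w '' {i | i < r}))) (1 + lam r) ∧
      IsGLB (ratiosPreconditioned μ ν C₁ (Submodule.span ℝ (w '' {i | i < r}))) (1 + lam r)) := by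
  have hf (z : H) (hz : z ≠ 0) := varRatio_eq_one_add_rayleighQuotient h₁ h₂ h0 hle hμ hν hz
  have hO {V : Submodule ℝ H} := ratiosOrthogonal_eq_image (V := V)
    (f := fun u => 1 + (feldmanHajek C₂ C₁).rayleighQuotient u) h₁ h0 hf
  have hP := ratiosPreconditioned_eq_image
    (f := fun u => 1 + (feldmanHajek C₂ C₁).rayleighQuotient u) h₁ h0 hf
  refine ⟨fun i => ?_, fun r => ⟨fun V _ hVr hV => ?_, ?_⟩⟩
  · obtain ⟨z, hz⟩ := hw.mem_range i
    have hz0 : z ≠ 0 := by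
      rintro rfl
      exact w.orthonormal.ne_zero i (by rw [← hz, map_zero])
    have hval : varRatio μ ν z = 1 + lam i := by
      rw [hf z hz0, hz, rayleighQuotient_basis hw]
    -- Definiteness of C₂ keeps the denominator 1 + λ_i away from zero.
    have hpos : 0 < 1 + lam i := by
      rw [← hval, varRatio, hμ, hν]
      exact div_pos (h0' z hz0) (h0 z hz0)
    refine ⟨by rw [← hz, invSqrt_opSqrt h₁ h0, hval], ?_⟩
    field_simp
    ring
  · obtain ⟨⟨u, hu0, huV, huS, hu⟩, hz⟩ := exists_varRatio_le h₁ h0 hf hI hw r hVr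
    refine ⟨?_, hz hV⟩
    obtain ⟨m, hm⟩ := exists_isLeast_rayleighQuotient h₁ h₂ h0 hle F hF hV hu0 huV huS
    refine ⟨m, ?_, ?_, (hm.2 ⟨u, ⟨hu0, huV, huS⟩, rfl⟩).trans (add_le_add_right hu 1)⟩
    · rwa [hO hV]
    · rw [hP]
      exact hm.isGLB
  · have hm := isLeast_rayleighQuotient_span hw r
    have hV : (Submodule.span ℝ (w '' {i | i < r}) : Set H) ⊆ Set.range (opSqrt C₁) := by
      have : Submodule.span ℝ (w '' {i | i < r}) ≤ (opSqrt C₁).range := by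
        rw [Submodule.span_le]
        rintro _ ⟨i, -, rfl⟩
        exact hw.mem_range i
      exact this
    rw [hO hV, hP]
    exact ⟨hm, hm.isGLB⟩

end Ratios

/-! ### Second moments and covariance operators. -/

lemma memLp_id_map_const_add {E : Type*} [NormedAddCommGroup E] [MeasurableSpace E] [BorelSpace E]
    {μ : Measure E} [IsFiniteMeasure μ] (h : MemLp id 2 μ) (c : E) :
    MemLp id 2 (μ.map fun x => c + x) :=
  (measurableEmbedding_addLeft c).memLp_map_measure_iff.mpr ((memLp_const c).add h)

section Covariance

variable {H : Type*} [NormedAddCommGroup H] [InnerProductSpace ℝ H] [CompleteSpace H]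
  [MeasurableSpace H] [BorelSpace H]

lemma inner_covOp (μ : Measure H) (x y : H) : ⟪covOp μ x, y⟫ = covarianceBilin μ x y :=
  continuousLinearMapOfBilin_apply _ x y

lemma isPositive_covOp (μ : Measure H) : (covOp μ).IsPositive := by
  refine (ContinuousLinearMap.isPositive_iff _).2 ⟨fun x y => ?_, fun x => ?_⟩
  · change ⟪covOp μ x, y⟫ = ⟪x, covOp μ y⟫
    rw [inner_covOp, real_inner_comm, inner_covOp, covarianceBilin_comm]
  · rw [inner_covOp]
    exact covarianceBilin_self_nonneg x

lemma variance_inner_eq_inner_covOp {μ : Measure H} [IsFiniteMeasure μ] (h : MemLp id 2 μ)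
    (z : H) : Var[fun x => ⟪x, z⟫; μ] = ⟪covOp μ z, z⟫ := by
  rw [inner_covOp, covarianceBilin_self h]
  simp only [real_inner_comm]

lemma IsNondegenerateCenteredGaussian.inner_covOp_pos [SecondCountableTopology H]
    {μ : Measure H} (h : IsNondegenerateCenteredGaussian μ) {z : H} (hz : z ≠ 0) :
    0 < ⟪covOp μ z, z⟫ := by
  have := h.gaussian
  rw [← variance_inner_eq_inner_covOp (IsGaussian.memLp_two_id)]
  exact h.nondegenerate z hz

variable [SecondCountableTopology H] {Ω : Type*} [MeasurableSpace Ω] {P : Measure Ω}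
  [IsProbabilityMeasure P] {X : Ω → H}

lemma inner_covOp_map (hX : MemLp X 2 P) (x y : H) :
    ⟪covOp (P.map X) x, y⟫ = cov[fun ω => ⟪x, X ω⟫, fun ω => ⟪y, X ω⟫; P] := by
  have hXm := hX.aestronglyMeasurable.aemeasurable
  have := Measure.isProbabilityMeasure_map hXm
  rw [inner_covOp, covarianceBilin_apply_eq_cov
    ((memLp_map_measure_iff aestronglyMeasurable_id hXm).2 hX),
    covariance_map_fun (by fun_prop) (by fun_prop) hXm]

variable {E F F' : Type*} [NormedAddCommGroup E] [InnerProductSpace ℝ E] [CompleteSpace E]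
  [MeasurableSpace E] [BorelSpace E] [SecondCountableTopology E]
  [NormedAddCommGroup F] [InnerProductSpace ℝ F] [CompleteSpace F]
  [NormedAddCommGroup F'] [InnerProductSpace ℝ F'] [CompleteSpace F'] {ζ : Ω → E}

/-- Covariances of linear combinations of two independent square integrable random vectors. -/
lemma covariance_inner_add_of_indepFun (hX : MemLp X 2 P) (hζ : MemLp ζ 2 P)
    (h : IndepFun X ζ P) (A : H →L[ℝ] F) (B : E →L[ℝ] F) (A' : H →L[ℝ] F') (B' : E →L[ℝ] F')
    (x : F) (y : F') :
    cov[fun ω => ⟪x, A (X ω) + B (ζ ω)⟫, fun ω => ⟪y, A' (X ω) + B' (ζ ω)⟫; P] =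
      ⟪covOp (P.map X) (A.adjoint x), A'.adjoint y⟫ +
        ⟪covOp (P.map ζ) (B.adjoint x), B'.adjoint y⟫ := by
  have e1 : (fun ω => ⟪x, A (X ω) + B (ζ ω)⟫) =
      (fun ω => ⟪A.adjoint x, X ω⟫) + fun ω => ⟪B.adjoint x, ζ ω⟫ := by
    ext ω
    simp [inner_add_right, ContinuousLinearMap.adjoint_inner_left]
  have e2 : (fun ω => ⟪y, A' (X ω) + B' (ζ ω)⟫) =
      (fun ω => ⟪A'.adjoint y, X ω⟫) + fun ω => ⟪B'.adjoint y, ζ ω⟫ := by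
    ext ω
    simp [inner_add_right, ContinuousLinearMap.adjoint_inner_left]
  have c1 (u : H) (v : E) : cov[fun ω => ⟪u, X ω⟫, fun ω => ⟪v, ζ ω⟫; P] = 0 :=
    IndepFun.covariance_eq_zero (h.comp (measurable_const.inner measurable_id)
      (measurable_const.inner measurable_id)) (hX.const_inner u) (hζ.const_inner v)
  have c2 (u : H) (v : E) : cov[fun ω => ⟪v, ζ ω⟫, fun ω => ⟪u, X ω⟫; P] = 0 := by
    rw [covariance_comm, c1]
  have mX (u : H) : MemLp (fun ω => ⟪u, X ω⟫) 2 P := hX.const_inner u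
  have mζ (v : E) : MemLp (fun ω => ⟪v, ζ ω⟫) 2 P := hζ.const_inner v
  rw [e1, e2, covariance_add_left (mX _) (mζ _) ((mX _).add (mζ _)),
    covariance_add_right (mX _) (mX _) (mζ _), covariance_add_right (mζ _) (mX _) (mζ _),
    c1, c2, inner_covOp_map hX, inner_covOp_map hζ, add_zero, zero_add]

end Covariance

/-! ### Conditioning on an independent variable. -/

section CondDistrib

variable {E H Ω : Type*} [MeasurableSpace E] [MeasurableSpace H] [StandardBorelSpace H] [Nonempty H]
  [MeasurableSpace Ω] {P : Measure Ω} [IsProbabilityMeasure P]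

/-- If `Z` is independent of `Y`, the conditional distribution of `f (Y, Z)` given `Y = y` is the
law of `f (y, Z)`. -/
lemma condDistrib_of_indepFun {E' : Type*} [MeasurableSpace E'] {Y : Ω → E} {Z : Ω → E'}
    (hY : Measurable Y) (hZ : Measurable Z) (h : IndepFun Y Z P) {f : E × E' → H}
    (hf : Measurable f) :
    ∀ᵐ y ∂(P.map Y), condDistrib (fun ω => f (Y ω, Z ω)) Y P y =
      (P.map Z).map fun z => f (y, z) := by
  have := Measure.isProbabilityMeasure_map (μ := P) hY.aemeasurable
  have := Measure.isProbabilityMeasure_map (μ := P) hZ.aemeasurable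
  -- The candidate kernel y ↦ law of f(y, Z); it disintegrates the joint law since (Y, Z) has a
  -- product law, and disintegrations are almost everywhere unique.
  let κ : Kernel E H := (Kernel.id ×ₖ Kernel.const E (P.map Z)).map f
  have hκ (y : E) : κ y = (P.map Z).map fun z => f (y, z) := by
    rw [Kernel.map_apply _ hf, Kernel.prod_apply, Kernel.id_apply, Kernel.const_apply,
      Measure.dirac_prod, Measure.map_map hf (by fun_prop)]
    rfl
  have hfin : IsMarkovKernel κ := Kernel.IsMarkovKernel.map _ hf
  have key : P.map (fun ω => (Y ω, f (Y ω, Z ω))) = P.map Y ⊗ₘ κ := by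
    ext s hs
    have hg : Measurable fun p : E × E' => (p.1, f p) := by fun_prop
    have e : (fun ω => (Y ω, f (Y ω, Z ω))) =
      (fun p : E × E' => (p.1, f p)) ∘ fun ω => (Y ω, Z ω) := rfl
    rw [e, ← Measure.map_map hg (hY.prodMk hZ),
      (indepFun_iff_map_prod_eq_prod_map_map hY.aemeasurable hZ.aemeasurable).1 h,
      Measure.map_apply hg hs, Measure.prod_apply (hg hs), Measure.compProd_apply hs]
    refine lintegral_congr fun y => ?_
    rw [hκ, Measure.map_apply (by fun_prop) (measurable_prodMk_left hs)]
    rfl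
  filter_upwards [condDistrib_ae_eq_of_measure_eq_compProd Y
    (Y := fun ω => f (Y ω, Z ω)) (hf.comp (hY.prodMk hZ)).aemeasurable key] with y hy
  rw [hy, hκ]

end CondDistrib

/-! ### The gain operator. -/

section Gain

variable {H : Type*} [NormedAddCommGroup H] [InnerProductSpace ℝ H] [CompleteSpace H]

/-- The adjoint of the gain operator: `N` with `(G C G^* + Cobs) N = G C`. -/
lemma exists_gain {E : Type*} [NormedAddCommGroup E] [InnerProductSpace ℝ E]
    [FiniteDimensional ℝ E] [CompleteSpace E] {C : H →L[ℝ] H} (hC : C.IsPositive) {D : E →L[ℝ] E}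
    (hD : ∀ y ≠ 0, 0 < ⟪D y, y⟫) (G : H →L[ℝ] E) :
    ∃ N : H →L[ℝ] E, ∀ x, G (C (G.adjoint (N x))) + D (N x) = G (C x) := by
  let T : E →ₗ[ℝ] E := (G ∘L C ∘L G.adjoint + D : E →L[ℝ] E)
  -- The form of T dominates that of D, which is definite; in finite dimension injectivity gives
  -- invertibility.
  have hT : Function.Injective T := by
    refine (injective_iff_map_eq_zero _).2 fun y hy => by_contra fun h => ?_
    have h1 : ⟪G (C (G.adjoint y)) + D y, y⟫ = 0 := by
      have : G (C (G.adjoint y)) + D y = 0 := hy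
      rw [this, inner_zero_left]
    rw [inner_add_left, ← ContinuousLinearMap.adjoint_inner_right] at h1
    have h2 := hC.inner_nonneg_left (G.adjoint y)
    linarith [hD y h]
  let e := LinearEquiv.ofInjectiveEndo T hT
  refine ⟨(e.symm : E →ₗ[ℝ] E).toContinuousLinearMap ∘L G ∘L C, fun x => ?_⟩
  exact e.apply_symm_apply (G (C x))

/-- The normal equation in weak form: it yields both the decorrelation of Y and Z and the formula
for C₁ - C₂. -/
lemma inner_gain {E : Type*} [NormedAddCommGroup E] [InnerProductSpace ℝ E] [CompleteSpace E]
    {C : H →L[ℝ] H} {D : E →L[ℝ] E} {G N : H →L[ℝ] E}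
    (hN : ∀ x, G (C (G.adjoint (N x))) + D (N x) = G (C x)) (x : H) (u : E) :
    ⟪C (G.adjoint (N x)), G.adjoint u⟫ + ⟪D (N x), u⟫ = ⟪C x, G.adjoint u⟫ := by
  rw [ContinuousLinearMap.adjoint_inner_right, ContinuousLinearMap.adjoint_inner_right,
    ← inner_add_left, hN]

end Gain

/-! ### The posterior as a translated Gaussian residual. -/

section Posterior

variable {H : Type*} [NormedAddCommGroup H] [InnerProductSpace ℝ H] [CompleteSpace H]
  [SecondCountableTopology H] [MeasurableSpace H] [BorelSpace H]
  {Ω : Type*} [MeasurableSpace Ω] {P : Measure Ω} [IsProbabilityMeasure P] {n : ℕ}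
  {X : Ω → H} {ζ : Ω → EuclideanSpace ℝ (Fin n)} {G : H →L[ℝ] EuclideanSpace ℝ (Fin n)}

/-- Almost every posterior is square integrable, with covariance operator `C - C G^* N`. -/
theorem ae_posterior_covOp (hXmeas : Measurable X) (hζmeas : Measurable ζ)
    (hX : IsNondegenerateCenteredGaussian (P.map X))
    (hζ : IsNondegenerateCenteredGaussian (P.map ζ)) (hindep : IndepFun X ζ P)
    {N : H →L[ℝ] EuclideanSpace ℝ (Fin n)}
    (hN : ∀ x, G (covOp (P.map X) (G.adjoint (N x))) + covOp (P.map ζ) (N x) =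
      G (covOp (P.map X) x)) :
    ∀ᵐ y ∂(P.map (fun ω => G (X ω) + ζ ω)),
      IsFiniteMeasure (posterior P X ζ G y) ∧ MemLp id 2 (posterior P X ζ G y) ∧
      (∀ x x', ⟪covOp (posterior P X ζ G y) x, x'⟫ =
        ⟪covOp (P.map X) (x - G.adjoint (N x)), x' - G.adjoint (N x')⟫ +
          ⟪covOp (P.map ζ) (N x), N x'⟫) := by
  have hXg : HasGaussianLaw X P := ⟨hX.gaussian⟩
  have hζg : HasGaussianLaw ζ P := ⟨hζ.gaussian⟩
  have hXζ := hindep.hasGaussianLaw hXg hζg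
  have hCsym (a b : H) := (isPositive_covOp (P.map X)).inner_left_eq_inner_right a b
  -- Z = X - N*Y, written as A X + B ζ in terms of the independent inputs.
  let A : H →L[ℝ] H := .id ℝ H - N.adjoint ∘L G
  let B : EuclideanSpace ℝ (Fin n) →L[ℝ] H := -N.adjoint
  let Y : Ω → EuclideanSpace ℝ (Fin n) := fun ω => G (X ω) + ζ ω
  let Z : Ω → H := fun ω => A (X ω) + B (ζ ω)
  have hYm : Measurable Y := by fun_prop
  have hZm : Measurable Z := by fun_prop
  have hA (x : H) : A.adjoint x = x - G.adjoint (N x) := by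
    simp [A, ContinuousLinearMap.adjoint_comp, ContinuousLinearMap.adjoint_id]
  have hB (x : H) : B.adjoint x = -N x := by simp [B]
  have hXZ (ω : Ω) : X ω = N.adjoint (Y ω) + Z ω := by
    simp only [Y, Z, A, B, map_add, sub_apply, neg_apply, ContinuousLinearMap.comp_apply,
      ContinuousLinearMap.id_apply]
    abel
  clear_value A B
  have hYZ : HasGaussianLaw (fun ω => (Y ω, Z ω)) P := by
    have := hXζ.map ((G ∘L .fst ℝ H _ + .snd ℝ H _).prod (A ∘L .fst ℝ H _ + B ∘L .snd ℝ H _))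
    exact this
  have hind : IndepFun Y Z P := by
    -- Jointly Gaussian and uncorrelated implies independent; the cross covariance vanishes by the
    -- gain equation.
    refine hYZ.indepFun_of_covariance_inner fun y x => ?_
    have h := covariance_inner_add_of_indepFun hXg.memLp_two hζg.memLp_two hindep G
      (.id ℝ (EuclideanSpace ℝ (Fin n))) A B y x
    refine h.trans ?_
    have h1 := inner_gain hN x y
    rw [hA, hB, ContinuousLinearMap.adjoint_id, ContinuousLinearMap.id_apply, hCsym, map_sub,
      inner_sub_right, inner_neg_right,
      (isPositive_covOp (P.map ζ)).inner_left_eq_inner_right, real_inner_comm _ (G.adjoint y),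
      real_inner_comm _ (G.adjoint y), real_inner_comm _ y, ← h1]
    ring
  have hZ2 : MemLp Z 2 P := hYZ.snd.memLp_two
  have hZp := Measure.isProbabilityMeasure_map (μ := P) hZm.aemeasurable
  filter_upwards [condDistrib_of_indepFun hYm hZm hind
    (f := fun p : EuclideanSpace ℝ (Fin n) × H => N.adjoint p.1 + p.2) (by fun_prop)] with y hy
  have hpost : posterior P X ζ G y = (P.map Z).map (fun z => N.adjoint y + z) := by
    rw [← hy]
    change condDistrib X Y P y = _
    simp only [← hXZ]
  have hZid : MemLp id 2 (P.map Z) :=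
    (memLp_map_measure_iff aestronglyMeasurable_id hZm.aemeasurable).2 hZ2
  rw [hpost]
  refine ⟨inferInstance, ?_, fun x x' => ?_⟩
  · exact memLp_id_map_const_add hZid _
  · rw [inner_covOp, covarianceBilin_map_const_add, ← inner_covOp, inner_covOp_map hZ2]
    refine (covariance_inner_add_of_indepFun hXg.memLp_two hζg.memLp_two hindep A B A B
      x x').trans ?_
    rw [hA, hA, hB, hB]
    simp

end Posterior

end LinearGaussianInverse

/-! ### Assembly of the theorem. -/

theorem mainTheorem7
    {H : Type*} [NormedAddCommGroup H] [InnerProductSpace ℝ H] [CompleteSpace H]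
    [SecondCountableTopology H] [MeasurableSpace H] [BorelSpace H]
    {Ω : Type*} [MeasurableSpace Ω] (P : Measure Ω) [IsProbabilityMeasure P] (n : ℕ)
    (X : Ω → H) (ζ : Ω → EuclideanSpace ℝ (Fin n)) (G : H →L[ℝ] EuclideanSpace ℝ (Fin n))
    (hXmeas : Measurable X) (hζmeas : Measurable ζ)
    (hX : LinearGaussianInverse.IsNondegenerateCenteredGaussian (P.map X))
    (hζ : LinearGaussianInverse.IsNondegenerateCenteredGaussian (P.map ζ))
    (hindep : IndepFun X ζ P) :
    ∀ᵐ y ∂(P.map (fun ω => G (X ω) + ζ ω)),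
      ∀ (μpr μpos : Measure H) (Cpr Cpos : H →L[ℝ] H),
      μpr = P.map X → μpos = LinearGaussianInverse.posterior P X ζ G y →
      Cpr = LinearGaussianInverse.covOp μpr → Cpos = LinearGaussianInverse.covOp μpos →
      ∀ (I : Set ℕ) (_ : IsLowerSet I) (lam : I → ℝ) (w : HilbertBasis I ℝ H),
      LinearGaussianInverse.IsEigensystem Cpos Cpr lam w →
      -- the relative variance along the directions `Cpr^{-1/2} w i`
      (∀ i : I,
        LinearGaussianInverse.varRatio μpos μpr (LinearGaussianInverse.invSqrt Cpr (w i))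
          = 1 + lam i ∧
        1 + lam i = 1 / (1 + (-lam i) / (1 + lam i))) ∧
      -- indices start at `0`, so `lam r` is the `(r + 1)`-st eigenvalue
      (∀ r : I,
        (∀ V : Submodule ℝ H, FiniteDimensional ℝ V → Module.finrank ℝ V = (r : ℕ) →
          (V : Set H) ⊆ Set.range (LinearGaussianInverse.opSqrt Cpr) →
          (∃ m : ℝ,
            IsLeast (LinearGaussianInverse.ratiosOrthogonal μpos μpr Cpr V) m ∧
            IsGLB (LinearGaussianInverse.ratiosPreconditioned μpos μpr Cpr V) m ∧
            m ≤ 1 + lam r) ∧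
          -- the upper bound also holds for orthogonality in the inner product of `H`
          (∃ z : H, z ≠ 0 ∧ (∀ v ∈ V, ⟪z, LinearGaussianInverse.invSqrt Cpr v⟫ = 0) ∧
            LinearGaussianInverse.varRatio μpos μpr z ≤ 1 + lam r)) ∧
        IsLeast (LinearGaussianInverse.ratiosOrthogonal μpos μpr Cpr
          (Submodule.span ℝ (w '' {i | i < r}))) (1 + lam r) ∧
        IsGLB (LinearGaussianInverse.ratiosPreconditioned μpos μpr Cpr
          (Submodule.span ℝ (w '' {i | i < r}))) (1 + lam r)) := by
  obtain ⟨N, hN⟩ := LinearGaussianInverse.exists_gain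
    (LinearGaussianInverse.isPositive_covOp (P.map X))
    (D := LinearGaussianInverse.covOp (P.map ζ)) (fun y hy => hζ.inner_covOp_pos hy) G
  filter_upwards [LinearGaussianInverse.ae_posterior_covOp hXmeas hζmeas hX hζ hindep hN] with y hy
  obtain ⟨hfin, hL2, hcov⟩ := hy
  rintro μpr μpos Cpr Cpos rfl rfl rfl rfl I hI lam w hw
  have hXg := hX.gaussian
  -- Expanding the posterior covariance, the terms quadratic in N cancel by the gain equation. The
  -- difference maps into Cpr(ran G*), which gives finite rank.
  have hCpos (z : H) : LinearGaussianInverse.covOp (P.map X) z -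
      LinearGaussianInverse.covOp (LinearGaussianInverse.posterior P X ζ G y) z =
      LinearGaussianInverse.covOp (P.map X) (G.adjoint (N z)) := by
    refine ext_inner_right ℝ fun x => ?_
    have h1 := LinearGaussianInverse.inner_gain hN z (N x)
    rw [inner_sub_left, hcov]
    simp only [map_sub, inner_sub_left, inner_sub_right]
    linarith
  have h0 (z : H) (hz : z ≠ 0) := hX.inner_covOp_pos hz
  have hN0 (z : H) : 0 ≤ ⟪LinearGaussianInverse.covOp (P.map X) (G.adjoint (N z)), z⟫ := by
    have h1 := LinearGaussianInverse.inner_gain hN z (N z)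
    have h2 := (LinearGaussianInverse.isPositive_covOp (P.map X))
    rw [h2.inner_left_eq_inner_right, real_inner_comm, ← h1]
    exact add_nonneg (h2.inner_nonneg_left _)
      ((LinearGaussianInverse.isPositive_covOp (P.map ζ)).inner_nonneg_left _)
  refine LinearGaussianInverse.relative_variance_of_isEigensystem
    (LinearGaussianInverse.isPositive_covOp _) (LinearGaussianInverse.isPositive_covOp _) h0
    (fun z hz => ?_) (fun z => ?_) G.adjoint.range (fun z => ⟨_, ⟨N z, rfl⟩, hCpos z⟩)
    (LinearGaussianInverse.variance_inner_eq_inner_covOp hL2)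
    (LinearGaussianInverse.variance_inner_eq_inner_covOp IsGaussian.memLp_two_id) hI hw
  · rw [hcov]
    -- If N z = 0 the prior term is positive; otherwise the noise term is.
    rcases eq_or_ne (N z) 0 with hz0 | hz0
    · simpa [hz0] using h0 z hz
    · exact add_pos_of_nonneg_of_pos
        ((LinearGaussianInverse.isPositive_covOp (P.map X)).inner_nonneg_left _)
        (hζ.inner_covOp_pos hz0)
  · have h1 := congrArg (fun v => ⟪v, z⟫) (hCpos z)
    simp only [inner_sub_left] at h1
    linarith [hN0 z]
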